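/- Let $d,g\ge 1$ and $k_1,\dots,k_g\ge 1$ be integers with $k_x\ge 2$ for at least one $x\in[g]:=\{1,\dots,g\}$. A measurement (POVM) on $\mathbb C^d$ with $k$ outcomes is a tuple $(E_i)_{i\in[k]}$ of positive semidefinite $d\times d$ complex matrices with $\sum_i E_i=I_d$. A tuple $E=(E_{\cdot|x})_{x\in[g]}$ of measurements, with $k_x$ outcomes respectively, is compatible if there is a POVM $(J_{i_1,\dots,i_g})_{i_1\in[k_1],\dots,i_g\in[k_g]}$ on $\mathbb C^d$ such that $E_{i|x}=\sum_{(i_1,\dots,i_g):\, i_x=i}J_{i_1,\dots,i_g}$ for all $x\in[g]$ and $i\in[k_x]$. For $s\in[0,1]$ put $E_{i|x}(s):=sE_{i|x}+(1-s)I_d/k_x$, let $s_{\mathbb C}(E)$ be the largest $s\in[0,1]$ such that the measurements $(E_{i|x}(s))_{i\in[k_x]}$, $x\in[g]$, are compatible, and let $s_{\mathbb C}(d,g,(k_1,\dots,k_g))$ be the minimum of $s_{\mathbb C}(E)$ over all $g$-tuples $E$ of measurements on $\mathbb C^d$ with $k_1,\dots,k_g$ outcomes. Then the optimization problem $$ \begin{aligned}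 \text{maximize}\quad & \frac1d\sum_{x\in[g]}\sum_{i\in[k_x-1]}\operatorname{tr}\left(A_{i|x}X_{i|x}\right)\\ \text{subject to}\quad & -\tfrac{k_x}{2}A_{i|x}\preceq N && \forall\, i\in[k_x-1],\ x\in[g],\\ & \tfrac{k_x}{2}\sum_{i\in[k_x-1]}A_{i|x}\preceq N && \forall\, x\in[g],\\ & \sum_{x\in[g]}\sum_{i\in[k_x-1]}\left(-\tfrac{2}{k_x}+2\delta_{i,j_x}\right)X_{i|x}\preceq I_d && \forall\, j\in[k_1]\times\dots\times[k_g],\\ & N\succeq 0,\qquad \tfrac1d\operatorname{tr}(N)=1, \end{aligned} $$ over Hermitian $d\times d$ complex matrices $A_{i|x},X_{i|x}$ ($i\in[k_x-1]$, $x\in[g]$) and $N$, attains its maximum, and the optimal value is $1/s_{\mathbb C}(d,g,(k_1,\dots,k_g))$. -/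

import Mathlib

open scoped ComplexOrder

/-- A measurement (POVM) on `ℂ^d` with outcomes in the finite type `ι`. -/
structure IsPOVM {d : ℕ} {ι : Type*} [Fintype ι] (E : ι → Matrix (Fin d) (Fin d) ℂ) : Prop where
  posSemidef : ∀ i, (E i).PosSemidef
  sum_eq_one : ∑ i, E i = 1

/-- `E x i` is the effect of outcome `i` of measurement `x`. The tuple is compatible if it
consists of the marginals of one joint POVM, indexed by tuples of outcomes. -/
def Compatible {d g : ℕ} {k : Fin g → ℕ}
    (E : (x : Fin g) → Fin (k x) → Matrix (Fin d) (Fin d) ℂ) : Prop :=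
  ∃ J : ((x : Fin g) → Fin (k x)) → Matrix (Fin d) (Fin d) ℂ,
    IsPOVM J ∧
      ∀ (x : Fin g) (i : Fin (k x)),
        E x i = ∑ j : (y : Fin g) → Fin (k y), if j x = i then J j else 0

/-- White noise: `E_{i|x}(s) = s E_{i|x} + (1 - s) I / k_x`. -/
noncomputable def noisy {d g : ℕ} {k : Fin g → ℕ} (s : ℝ)
    (E : (x : Fin g) → Fin (k x) → Matrix (Fin d) (Fin d) ℂ) :
    (x : Fin g) → Fin (k x) → Matrix (Fin d) (Fin d) ℂ :=
  fun x i => s • E x i + ((1 - s) / (k x : ℝ)) • (1 : Matrix (Fin d) (Fin d) ℂ)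

/-- The compatibility degree of a tuple of measurements, the largest `s ∈ [0, 1]` for which the
noisy measurements are compatible. -/
noncomputable def compatibilityDegree {d g : ℕ} {k : Fin g → ℕ}
    (E : (x : Fin g) → Fin (k x) → Matrix (Fin d) (Fin d) ℂ) : ℝ :=
  sSup {s : ℝ | s ∈ Set.Icc (0 : ℝ) 1 ∧ Compatible (noisy s E)}

/-- The minimum compatibility degree `s_ℂ(d, g, k)` over all `g`-tuples of measurements on `ℂ^d`
with `k x` outcomes for the measurement `x`. -/
noncomputable def minCompatibilityDegree (d g : ℕ) (k : Fin g → ℕ) : ℝ :=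
  sInf {s : ℝ | ∃ E : (x : Fin g) → Fin (k x) → Matrix (Fin d) (Fin d) ℂ,
    (∀ x, IsPOVM (E x)) ∧ s = compatibilityDegree E}

/-- The feasible points `(A, X, N)` of the trace-objective problem; an inequality `P ⪯ Q` of
Hermitian matrices is `(Q - P).PosSemidef`. For each `x` the index `i` runs over the first
`k x - 1` outcomes. -/
structure TraceFeasible {d g : ℕ} {k : Fin g → ℕ}
    (A X : (x : Fin g) → Fin (k x - 1) → Matrix (Fin d) (Fin d) ℂ)
    (N : Matrix (Fin d) (Fin d) ℂ) : Prop where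
  hermitian_A : ∀ x i, (A x i).IsHermitian
  hermitian_X : ∀ x i, (X x i).IsHermitian
  lower_A : ∀ x i, (N - (-((k x : ℝ) / 2)) • A x i).PosSemidef
  upper_A : ∀ x, (N - ((k x : ℝ) / 2) • ∑ i, A x i).PosSemidef
  constraint_X : ∀ j : (x : Fin g) → Fin (k x),
    ((1 : Matrix (Fin d) (Fin d) ℂ) -
      ∑ x, ∑ i : Fin (k x - 1),
        (-(2 / (k x : ℝ)) + 2 * (if (i : ℕ) = (j x : ℕ) then 1 else 0)) • X x i).PosSemidef
  posSemidef_N : N.PosSemidef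
  trace_N : (1 / (d : ℂ)) * N.trace = 1

/-- The objective `(1/d) ∑ tr(A_{i|x} X_{i|x})`; the sum of traces is real for Hermitian matrices,
so taking the real part changes nothing at feasible points. -/
noncomputable def traceObjective {d g : ℕ} {k : Fin g → ℕ}
    (A X : (x : Fin g) → Fin (k x - 1) → Matrix (Fin d) (Fin d) ℂ) : ℝ :=
  (1 / (d : ℝ)) * (∑ x, ∑ i, (A x i * X x i).trace).re

/-! ### Hermitian and positive semidefinite complex matrices -/

section MatrixLemmas

set_option linter.unusedSectionVars false

open Matrix

variable {n : Type*} [Fintype n] [DecidableEq n]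

/-! The two halves of the theorem are weak and strong duality for joint measurability, linked by a
change of variables that trades the matrix $N$ for a conjugation.

If $N=B^*B$ is invertible and $C=B^{-1}$, then $\frac12 C^*A_{i|x}C$ is the deviation of an effect
$E_{i|x}$ from $I/k_x$; the constraints on $A$ say exactly that these effects form measurements. If
a joint POVM $J$ exists at noise level $s$, the objective times $s$ becomes
$\frac1d\sum_j\operatorname{tr}(J_j\,BS_jB^*)$, where $S_j$ is the `outcomeSum` of $X$. As
$S_j\preceq I$, this is at most $\frac1d\operatorname{tr}(BB^*)=1$. Singular $N$ are reached by
mixing with the identity (`TraceFeasible.exists_mul_traceObjective_le_one`,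
`TraceFeasible.minCompatibilityDegree_mul_le_one`).

Conversely, if the measurements at level $s>0$ are incompatible, Hahn–Banach separates them from the
closed convex cone of marginals. The separating functional, rewritten in $k_x-1$ coordinates per
measurement, perturbed and normalised, yields a feasible point with value above $1/s$
(`exists_traceFeasible_of_not_compatible`).

The feasible set is compact, so a maximum $V$ exists. By the second half no tuple is incompatible at
level $1/V$; by the first half the minimum degree cannot exceed $1/V$. -/

open scoped MatrixOrder in
theorem Matrix.PosSemidef.exists_eq_conjTranspose_mul_self {M : Matrix n n ℂ}
    (hM : M.PosSemidef) : ∃ B : Matrix n n ℂ, M = Bᴴ * B :=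
  CStarAlgebra.nonneg_iff_eq_star_mul_self.mp (nonneg_iff_posSemidef.mpr hM)

theorem Matrix.PosDef.exists_eq_conjTranspose_mul_self {M : Matrix n n ℂ} (hM : M.PosDef) :
    ∃ B C : Matrix n n ℂ, M = Bᴴ * B ∧ B * C = 1 ∧ C * B = 1 := by
  obtain ⟨B, hB⟩ := hM.posSemidef.exists_eq_conjTranspose_mul_self
  have h1 : (M⁻¹ * Bᴴ) * B = 1 := by
    rw [Matrix.mul_assoc, ← hB, Matrix.nonsing_inv_mul]
    exact (Matrix.isUnit_iff_isUnit_det _).mp hM.isUnit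
  exact ⟨B, _, hB, mul_eq_one_comm.mp h1, h1⟩

/-- The $2\times2$ minor on $a,b$ gives $|M_{ab}|^2\le M_{aa}M_{bb}$, and each diagonal entry is at
most the trace. All compactness arguments rest on this bound. -/
theorem Matrix.PosSemidef.norm_apply_le {M : Matrix n n ℂ} (hM : M.PosSemidef) (a b : n) :
    ‖M a b‖ ≤ M.trace.re := by
  have hdiag : ∀ c, (M c c).im = 0 ∧ 0 ≤ (M c c).re := fun c => by
    have h := hM.diag_nonneg (i := c)
    rw [Complex.le_def] at h
    exact ⟨h.2.symm, h.1⟩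
  have hle : ∀ c, (M c c).re ≤ M.trace.re := fun c => by
    rw [Matrix.trace, Complex.re_sum]
    exact Finset.single_le_sum (f := fun i => (M.diag i).re)
      (fun i _ => (hdiag i).2) (Finset.mem_univ c)
  have hdet := (hM.submatrix ![a, b]).det_nonneg
  rw [Matrix.det_fin_two] at hdet
  simp only [submatrix_apply, cons_val_zero, cons_val_one] at hdet
  have hba : M b a = star (M a b) := (hM.isHermitian.apply b a).symm
  rw [hba, Complex.star_def, Complex.mul_conj, Complex.le_def] at hdet
  have h := hdet.1
  simp only [Complex.zero_re, Complex.sub_re, Complex.mul_re, (hdiag a).1, (hdiag b).1,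
    Complex.ofReal_re, Complex.normSq_eq_norm_sq] at h
  have := hle a
  have := hle b
  have := (hdiag a).2
  have := (hdiag b).2
  refine abs_le_of_sq_le_sq' ?_ (by linarith) |>.2
  nlinarith

theorem Matrix.PosSemidef.re_trace_mul_nonneg {P Q : Matrix n n ℂ} (hP : P.PosSemidef)
    (hQ : Q.PosSemidef) : 0 ≤ (P * Q).trace.re := by
  obtain ⟨B, rfl⟩ := hP.exists_eq_conjTranspose_mul_self
  rw [Matrix.mul_assoc, Matrix.trace_mul_comm]
  exact (Complex.le_def.mp (hQ.mul_mul_conjTranspose_same B).trace_nonneg).1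

theorem Matrix.PosSemidef.re_trace_nonneg {P : Matrix n n ℂ} (hP : P.PosSemidef) :
    0 ≤ P.trace.re :=
  (Complex.le_def.mp hP.trace_nonneg).1

/-- Self-duality of the positive semidefinite cone: rank-one $P=xx^*$ already recover the quadratic
form of $T$. -/
theorem Matrix.IsHermitian.posSemidef_of_re_trace_mul_nonneg {T : Matrix n n ℂ}
    (hT : T.IsHermitian) (h : ∀ P : Matrix n n ℂ, P.PosSemidef → 0 ≤ (T * P).trace.re) :
    T.PosSemidef := by
  refine PosSemidef.of_dotProduct_mulVec_nonneg hT fun x => ?_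
  have h1 := h _ (posSemidef_vecMulVec_self_star x)
  rw [Matrix.mul_vecMulVec, Matrix.trace_vecMulVec, dotProduct_comm] at h1
  rw [Complex.le_def]
  exact ⟨h1, (hT.im_star_dotProduct_mulVec_self x).symm⟩

theorem Matrix.PosSemidef.real_smul {P : Matrix n n ℂ} (hP : P.PosSemidef) {c : ℝ}
    (hc : 0 ≤ c) : (c • P).PosSemidef :=
  hP.smul hc

theorem Matrix.IsHermitian.real_smul {P : Matrix n n ℂ} (hP : P.IsHermitian) (c : ℝ) :
    (c • P).IsHermitian := by
  rw [Matrix.IsHermitian, Matrix.conjTranspose_smul, hP.eq, star_trivial]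

theorem Matrix.IsHermitian.sum {ι : Type*} {s : Finset ι} {P : ι → Matrix n n ℂ}
    (hP : ∀ i ∈ s, (P i).IsHermitian) : (∑ i ∈ s, P i).IsHermitian := by
  rw [Matrix.IsHermitian, Matrix.conjTranspose_sum]
  exact Finset.sum_congr rfl fun i hi => (hP i hi).eq

theorem Matrix.isClosed_setOf_isHermitian : IsClosed {M : Matrix n n ℂ | M.IsHermitian} :=
  isClosed_eq (by fun_prop) continuous_id

theorem Matrix.isClosed_setOf_posSemidef : IsClosed {M : Matrix n n ℂ | M.PosSemidef} := by
  have : {M : Matrix n n ℂ | M.PosSemidef} =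
      {M | M.IsHermitian} ∩ ⋂ x : n → ℂ, {M | 0 ≤ star x ⬝ᵥ (M *ᵥ x)} := by
    ext M
    simp [Matrix.posSemidef_iff_dotProduct_mulVec]
  rw [this]
  refine isClosed_setOf_isHermitian.inter (isClosed_iInter fun x => ?_)
  exact isClosed_le continuous_const (by fun_prop)

theorem Matrix.isCompact_setOf_norm_apply_le (R : ℝ) :
    IsCompact {M : Matrix n n ℂ | ∀ a b, ‖M a b‖ ≤ R} := by
  have : {M : Matrix n n ℂ | ∀ a b, ‖M a b‖ ≤ R} =
      Set.pi Set.univ fun _ => Set.pi Set.univ fun _ => Metric.closedBall (0 : ℂ) R := by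
    ext M
    refine ⟨fun h a _ b _ => by simpa using h a b, fun h a b => ?_⟩
    simpa using h a trivial b trivial
  rw [this]
  exact isCompact_univ_pi fun _ => isCompact_univ_pi fun _ => isCompact_closedBall _ _

/-- Since $f$ is only real-linear, its values at $e_{ab}$ and $ie_{ab}$ must both enter the entry
$Y_{ba}$. Against Hermitian $M$, the matrices $Y$ and $Y^*$ have the same real pairing, so $Y$ may
be replaced by its Hermitian part. -/
theorem Matrix.exists_re_trace_mul_eq (f : Matrix n n ℂ →ₗ[ℝ] ℝ) :
    ∃ Y : Matrix n n ℂ, Y.IsHermitian ∧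
      ∀ M : Matrix n n ℂ, M.IsHermitian → f M = (Y * M).trace.re := by
  let Y : Matrix n n ℂ := Matrix.of fun b a =>
    ((f (Matrix.single a b 1) : ℝ) : ℂ) - Complex.I * (f (Matrix.single a b Complex.I) : ℝ)
  have hY : ∀ M : Matrix n n ℂ, f M = (Y * M).trace.re := fun M => by
    conv_lhs => rw [Matrix.matrix_eq_sum_single M]
    simp only [map_sum, Matrix.trace, Matrix.diag_apply, Matrix.mul_apply, Complex.re_sum]
    rw [Finset.sum_comm]
    refine Finset.sum_congr rfl fun b _ => Finset.sum_congr rfl fun a _ => ?_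
    have : Matrix.single a b (M a b) = (M a b).re • Matrix.single a b (1 : ℂ)
        + (M a b).im • Matrix.single a b Complex.I := by
      rw [Matrix.smul_single, Matrix.smul_single, ← Matrix.single_add]
      congr 1
      simp [Complex.real_smul, Complex.re_add_im]
    rw [this, map_add, map_smul, map_smul]
    simp [Y]
    ring
  have hconj : ∀ M : Matrix n n ℂ, M.IsHermitian → (Yᴴ * M).trace.re = (Y * M).trace.re :=
    fun M hM => by
      conv_lhs => rw [← hM.eq, ← Matrix.conjTranspose_mul, Matrix.trace_conjTranspose,
        Matrix.trace_mul_comm]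
      simp
  refine ⟨(1 / 2 : ℝ) • (Y + Yᴴ), ?_, fun M hM => ?_⟩
  · refine Matrix.IsHermitian.real_smul ?_ _
    rw [Matrix.IsHermitian, Matrix.conjTranspose_add, Matrix.conjTranspose_conjTranspose, add_comm]
  · rw [hY, Matrix.smul_mul, Matrix.add_mul, Matrix.trace_smul, Matrix.trace_add,
      Complex.smul_re, Complex.add_re, hconj M hM, smul_eq_mul]
    ring

end MatrixLemmas

/-! ### Sums over outcome tuples -/

section Outcomes

theorem Fin.sum_univ_castLE_pred_add_last {M : Type*} [AddCommMonoid M] {k : ℕ} (hk : 1 ≤ k)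
    (f : Fin k → M) :
    ∑ i, f i = ∑ i : Fin (k - 1), f (Fin.castLE (Nat.sub_le k 1) i) +
      f ⟨k - 1, by omega⟩ := by
  obtain ⟨m, rfl⟩ : ∃ m, k = m + 1 := ⟨k - 1, by omega⟩
  exact Fin.sum_univ_castSucc f

theorem Fintype.sum_pi_apply {ι : Type*} [Fintype ι] [DecidableEq ι] {α : ι → Type*}
    [∀ x, Fintype (α x)] {M : Type*} [AddCommMonoid M] (x : ι) (φ : α x → M) :
    ∑ j : (y : ι) → α y, φ (j x) =
      Fintype.card ((y : {y // y ≠ x}) → α y) • ∑ i, φ i := by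
  rw [← Equiv.sum_comp (Equiv.piSplitAt x α).symm, Fintype.sum_prod_type]
  simp [Finset.smul_sum, Equiv.piSplitAt]

variable {d g : ℕ} {k : Fin g → ℕ}

/-- The matrix `∑ₓ ∑ᵢ (-2/kₓ + 2 δ_{i,jₓ}) X_{i|x}`. -/
noncomputable def outcomeSum (X : (x : Fin g) → Fin (k x - 1) → Matrix (Fin d) (Fin d) ℂ)
    (j : (x : Fin g) → Fin (k x)) : Matrix (Fin d) (Fin d) ℂ :=
  ∑ x, ∑ i : Fin (k x - 1),
    (-(2 / (k x : ℝ)) + 2 * (if (i : ℕ) = (j x : ℕ) then 1 else 0)) • X x i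

theorem outcomeSum_smul (c : ℝ) (X : (x : Fin g) → Fin (k x - 1) → Matrix (Fin d) (Fin d) ℂ)
    (j : (x : Fin g) → Fin (k x)) :
    outcomeSum (fun x i => c • X x i) j = c • outcomeSum X j := by
  simp only [outcomeSum, Finset.smul_sum]
  exact Finset.sum_congr rfl fun x _ => Finset.sum_congr rfl fun i _ => smul_comm _ _ _

theorem outcomeSum_conj (P Q : Matrix (Fin d) (Fin d) ℂ)
    (X : (x : Fin g) → Fin (k x - 1) → Matrix (Fin d) (Fin d) ℂ) (j : (x : Fin g) → Fin (k x)) :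
    outcomeSum (fun x i => P * X x i * Q) j = P * outcomeSum X j * Q := by
  simp only [outcomeSum, Finset.mul_sum, Finset.sum_mul, Matrix.mul_smul, Matrix.smul_mul]

theorem sum_coeff_eq_zero {k : ℕ} (i : Fin (k - 1)) :
    ∑ l : Fin k, (-(2 / (k : ℝ)) + 2 * (if (i : ℕ) = (l : ℕ) then 1 else 0)) = 0 := by
  have hk : (k : ℝ) ≠ 0 := by
    have := i.2
    exact_mod_cast (by omega : k ≠ 0)
  have h : ∀ l : Fin k, ((i : ℕ) = (l : ℕ)) ↔ (Fin.castLE (Nat.sub_le k 1) i = l) := fun l => by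
    simp [Fin.ext_iff]
  simp only [h, Finset.sum_add_distrib, ← Finset.mul_sum, Finset.sum_ite_eq, Finset.mem_univ,
    if_true, Finset.sum_const, Finset.card_univ, Fintype.card_fin, nsmul_eq_mul]
  field_simp
  ring

/-- For each $x$ and $i$, the coefficients $-2/k_x+2\delta_{i,l}$ sum to zero over $l\in[k_x]$.
Averaging over $j$ therefore eliminates $X$; this gives both positivity of $G$ and boundedness of
$X$ later. -/
theorem sum_outcomeSum (X : (x : Fin g) → Fin (k x - 1) → Matrix (Fin d) (Fin d) ℂ) :
    ∑ j : (x : Fin g) → Fin (k x), outcomeSum X j = 0 := by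
  simp only [outcomeSum]
  rw [Finset.sum_comm]
  refine Finset.sum_eq_zero fun x _ => ?_
  rw [Finset.sum_comm]
  refine Finset.sum_eq_zero fun i _ => ?_
  rw [← Finset.sum_smul, Fintype.sum_pi_apply (α := fun x => Fin (k x)) x (fun l : Fin (k x) =>
    -(2 / (k x : ℝ)) + 2 * (if (i : ℕ) = (l : ℕ) then 1 else 0)), sum_coeff_eq_zero, smul_zero,
    zero_smul]

theorem sum_marginals (x : Fin g) (J : ((x : Fin g) → Fin (k x)) → Matrix (Fin d) (Fin d) ℂ) :
    ∑ i : Fin (k x), ∑ j : (y : Fin g) → Fin (k y), (if j x = i then J j else 0) = ∑ j, J j := by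
  rw [Finset.sum_comm]
  simp

/-- The adjoint of taking marginals sends $Y$ to the family $j\mapsto\sum_x Y_{x,j_x}$. -/
theorem sum_trace_mul_marginals (Y : (x : Fin g) → Fin (k x) → Matrix (Fin d) (Fin d) ℂ)
    (J : ((x : Fin g) → Fin (k x)) → Matrix (Fin d) (Fin d) ℂ) :
    ∑ x, ∑ i, (Y x i * ∑ j : (y : Fin g) → Fin (k y), if j x = i then J j else 0).trace =
      ∑ j, ((∑ x, Y x (j x)) * J j).trace := by
  simp only [Finset.mul_sum, Finset.sum_mul, Matrix.trace_sum, mul_ite, mul_zero]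
  rw [Finset.sum_comm' (t' := Finset.univ) (s' := fun _ => Finset.univ) (by simp)]
  refine Finset.sum_congr rfl fun x _ => ?_
  rw [Finset.sum_comm]
  refine Finset.sum_congr rfl fun j _ => ?_
  rw [Finset.sum_eq_single (j x)] <;> simp +contextual [eq_comm]

end Outcomes

/-! ### Weak duality: feasible points bound the compatibility degree -/

section UpperBound

open Matrix

variable {d g : ℕ} {k : Fin g → ℕ}

theorem Compatible.smul_sub_eq {E : (x : Fin g) → Fin (k x) → Matrix (Fin d) (Fin d) ℂ} {s : ℝ}
    {J : ((x : Fin g) → Fin (k x)) → Matrix (Fin d) (Fin d) ℂ} (hJ : ∑ j, J j = 1)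
    (h : ∀ (x : Fin g) (i : Fin (k x)),
      noisy s E x i = ∑ j : (y : Fin g) → Fin (k y), if j x = i then J j else 0)
    (x : Fin g) (i : Fin (k x - 1)) :
    (2 * s) • (E x (Fin.castLE (Nat.sub_le _ 1) i) - (1 / (k x : ℝ)) • 1) =
      ∑ j : (y : Fin g) → Fin (k y),
        (-(2 / (k x : ℝ)) + 2 * (if (i : ℕ) = (j x : ℕ) then 1 else 0)) • J j := by
  have h1 := h x (Fin.castLE (Nat.sub_le _ 1) i)
  have h2 : ∀ j : (y : Fin g) → Fin (k y),
      ((-(2 / (k x : ℝ)) + 2 * (if (i : ℕ) = (j x : ℕ) then 1 else 0)) : ℝ) • J j =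
        (-(2 / (k x : ℝ))) • J j +
          (2 : ℝ) • (if j x = Fin.castLE (Nat.sub_le _ 1) i then J j else 0) := fun j => by
    have : ((i : ℕ) = (j x : ℕ)) ↔ j x = Fin.castLE (Nat.sub_le _ 1) i := by
      simp [Fin.ext_iff, eq_comm]
    simp only [this, add_smul]
    split_ifs <;> simp
  simp only [h2, Finset.sum_add_distrib, ← Finset.smul_sum, hJ, ← h1, noisy]
  module

theorem IsPOVM.of_pred {k : ℕ} (hk : 1 ≤ k) {D : Fin (k - 1) → Matrix (Fin d) (Fin d) ℂ}
    (h1 : ∀ i, (D i + (1 / (k : ℝ)) • (1 : Matrix (Fin d) (Fin d) ℂ)).PosSemidef)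
    (h2 : ((1 / (k : ℝ)) • (1 : Matrix (Fin d) (Fin d) ℂ) - ∑ i, D i).PosSemidef) :
    ∃ E : Fin k → Matrix (Fin d) (Fin d) ℂ, IsPOVM E ∧
      ∀ i, E (Fin.castLE (Nat.sub_le k 1) i) - (1 / (k : ℝ)) • 1 = D i := by
  have hlt : ∀ i : Fin (k - 1), ((Fin.castLE (Nat.sub_le k 1) i : Fin k) : ℕ) < k - 1 :=
    fun i => i.2
  let E : Fin k → Matrix (Fin d) (Fin d) ℂ := fun i =>
    if h : (i : ℕ) < k - 1 then D ⟨i, h⟩ + (1 / (k : ℝ)) • 1 else (1 / (k : ℝ)) • 1 - ∑ i, D i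
  have hE : ∀ i, E (Fin.castLE (Nat.sub_le k 1) i) = D i + (1 / (k : ℝ)) • 1 := fun i => by
    simp [E]
  refine ⟨E, ⟨fun i => ?_, ?_⟩, fun i => by rw [hE, add_sub_cancel_right]⟩
  · simp only [E]
    split_ifs
    exacts [h1 _, h2]
  · rw [Fin.sum_univ_castLE_pred_add_last hk]
    simp only [hE, Finset.sum_add_distrib, Finset.sum_const, Finset.card_univ, Fintype.card_fin]
    have hlast : E ⟨k - 1, by omega⟩ = (1 / (k : ℝ)) • 1 - ∑ i, D i := by simp [E]
    have hk0 : (k : ℝ) ≠ 0 := by exact_mod_cast (by omega : k ≠ 0)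
    rw [hlast, ← Nat.cast_smul_eq_nsmul ℝ, smul_smul, Nat.cast_sub hk, Nat.cast_one]
    have : (((k : ℝ) - 1) * (1 / k)) = 1 - 1 / k := by field_simp
    rw [this]
    module

/-- The measurements are read off from $A$ after conjugating $N$ to the identity, while $X$ serves
as an incompatibility witness for them. The tuple $E$ does not depend on $s$, so the bound passes to
the supremum. -/
theorem TraceFeasible.exists_mul_traceObjective_le_one (hd : 1 ≤ d) (hk : ∀ x, 1 ≤ k x)
    {A X : (x : Fin g) → Fin (k x - 1) → Matrix (Fin d) (Fin d) ℂ}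
    {N : Matrix (Fin d) (Fin d) ℂ} (h : TraceFeasible A X N) (hN : N.PosDef) :
    ∃ E : (x : Fin g) → Fin (k x) → Matrix (Fin d) (Fin d) ℂ, (∀ x, IsPOVM (E x)) ∧
      ∀ s : ℝ, Compatible (noisy s E) → s * traceObjective A X ≤ 1 := by
  obtain ⟨B, C, rfl, hBC, hCB⟩ := hN.exists_eq_conjTranspose_mul_self
  have hCB' : Bᴴ * Cᴴ = 1 := by rw [← conjTranspose_mul, hCB, conjTranspose_one]
  have hBC' : Cᴴ * Bᴴ = 1 := by rw [← conjTranspose_mul, hBC, conjTranspose_one]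
  have hone : Cᴴ * (Bᴴ * B) * C = 1 := by
    rw [← Matrix.mul_assoc, hBC', Matrix.one_mul, hBC]
  have hkpos : ∀ x, (0 : ℝ) < k x := fun x => by exact_mod_cast hk x
  have hPOVM : ∀ x, ∃ E : Fin (k x) → Matrix (Fin d) (Fin d) ℂ, IsPOVM E ∧
      ∀ i, E (Fin.castLE (Nat.sub_le (k x) 1) i) - (1 / (k x : ℝ)) • 1 =
        (1 / 2 : ℝ) • (Cᴴ * A x i * C) := fun x => by
    have hx := hkpos x
    have hc : 1 / (k x : ℝ) * (k x / 2) = 1 / 2 := by field_simp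
    refine IsPOVM.of_pred (hk x) (fun i => ?_) ?_
    · have := ((h.lower_A x i).conjTranspose_mul_mul_same C).real_smul
        (c := 1 / (k x : ℝ)) (by positivity)
      rw [Matrix.mul_sub, Matrix.sub_mul, hone, Matrix.mul_smul, Matrix.smul_mul, smul_sub,
        smul_smul, mul_neg, hc, neg_smul, sub_neg_eq_add, add_comm] at this
      exact this
    · have := ((h.upper_A x).conjTranspose_mul_mul_same C).real_smul
        (c := 1 / (k x : ℝ)) (by positivity)
      rw [Matrix.mul_sub, Matrix.sub_mul, hone, Matrix.mul_smul, Matrix.smul_mul, smul_sub,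
        smul_smul, hc, Finset.mul_sum, Finset.sum_mul, Finset.smul_sum] at this
      exact this
  choose E hE hED using hPOVM
  refine ⟨E, hE, fun s ⟨J, hJ, hJE⟩ => ?_⟩
  have hA : ∀ x i, A x i = (2 : ℝ) •
      (Bᴴ * (E x (Fin.castLE (Nat.sub_le _ 1) i) - (1 / (k x : ℝ)) • 1) * B) := fun x i => by
    have : Bᴴ * (Cᴴ * A x i * C) * B = (Bᴴ * Cᴴ) * A x i * (C * B) := by
      simp only [Matrix.mul_assoc]
    rw [hED, Matrix.mul_smul, Matrix.smul_mul, smul_smul, this, hCB, hCB']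
    norm_num
  -- Cyclicity moves $B$ and $B^*$ from $A$ onto $X$; expanding the deviations of $E$ in $J$ then
  -- collects the $X_{i|x}$ into `outcomeSum`.
  have hobj : (s : ℂ) * ∑ x, ∑ i, (A x i * X x i).trace =
      ∑ j, (J j * (B * outcomeSum X j * Bᴴ)).trace := by
    have h1 : ∀ x i, (s : ℂ) * (A x i * X x i).trace =
        ((2 * s) • (E x (Fin.castLE (Nat.sub_le _ 1) i) - (1 / (k x : ℝ)) • 1) *
          (B * X x i * Bᴴ)).trace := fun x i => by
      rw [hA, Matrix.smul_mul, Matrix.trace_smul, Matrix.smul_mul, Matrix.trace_smul,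
        Matrix.mul_assoc, Matrix.mul_assoc, Matrix.trace_mul_comm Bᴴ]
      simp only [Matrix.mul_assoc, Complex.real_smul]
      push_cast
      ring
    simp only [Finset.mul_sum, h1, Compatible.smul_sub_eq hJ.sum_eq_one hJE, ← outcomeSum_conj]
    simp only [outcomeSum, Finset.mul_sum, Finset.sum_mul, Matrix.trace_sum, Matrix.smul_mul,
      Matrix.mul_smul]
    rw [Finset.sum_comm (s := (Finset.univ : Finset ((y : Fin g) → Fin (k y))))]
    exact Finset.sum_congr rfl fun x _ => Finset.sum_comm
  have hre := congrArg Complex.re hobj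
  rw [Complex.re_ofReal_mul] at hre
  have hle : ∀ j, (J j * (B * outcomeSum X j * Bᴴ)).trace.re ≤ (J j * (B * Bᴴ)).trace.re :=
    fun j => by
      have := (hJ.posSemidef j).re_trace_mul_nonneg
        ((h.constraint_X j).mul_mul_conjTranspose_same B)
      rw [Matrix.mul_sub, Matrix.sub_mul, Matrix.mul_one, Matrix.mul_sub, Matrix.trace_sub,
        Complex.sub_re] at this
      exact sub_nonneg.mp this
  have hsum : ∑ j, (J j * (B * Bᴴ)).trace.re = d := by
    rw [← Complex.re_sum, ← Matrix.trace_sum, ← Finset.sum_mul, hJ.sum_eq_one, Matrix.one_mul,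
      Matrix.trace_mul_comm]
    have ht := h.trace_N
    have hd0 : (d : ℂ) ≠ 0 := by exact_mod_cast (by omega : d ≠ 0)
    rw [one_div, inv_mul_eq_one₀ hd0] at ht
    rw [← ht, Complex.natCast_re]
  have hd0 : (0 : ℝ) < d := by exact_mod_cast hd
  have : s * traceObjective A X ≤ (1 / (d : ℝ)) * d := by
    rw [traceObjective, mul_left_comm, hre, Complex.re_sum]
    refine mul_le_mul_of_nonneg_left ?_ (by positivity)
    rw [← hsum]
    exact Finset.sum_le_sum fun j _ => hle j
  rwa [one_div_mul_cancel hd0.ne'] at this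

end UpperBound

/-! ### The cone of marginals and its separating functionals -/

section Separation

open Matrix

variable {d g : ℕ} {k : Fin g → ℕ}

/-- The tuple of marginals of a family indexed by tuples of outcomes. -/
noncomputable def marginals (J : ((x : Fin g) → Fin (k x)) → Matrix (Fin d) (Fin d) ℂ) :
    (x : Fin g) → Fin (k x) → Matrix (Fin d) (Fin d) ℂ :=
  fun x i => ∑ j : (y : Fin g) → Fin (k y), if j x = i then J j else 0

theorem marginals_add (J K : ((x : Fin g) → Fin (k x)) → Matrix (Fin d) (Fin d) ℂ) :
    marginals (J + K) = marginals J + marginals K := by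
  ext1 x
  ext1 i
  simp only [marginals, Pi.add_apply, ← Finset.sum_add_distrib]
  refine Finset.sum_congr rfl fun j _ => ?_
  split_ifs <;> simp

theorem marginals_smul (c : ℝ) (J : ((x : Fin g) → Fin (k x)) → Matrix (Fin d) (Fin d) ℂ) :
    marginals (c • J) = c • marginals J := by
  ext1 x
  ext1 i
  simp only [marginals, Pi.smul_apply, Finset.smul_sum, smul_ite, smul_zero]

theorem continuous_marginals :
    Continuous (marginals : (((x : Fin g) → Fin (k x)) → Matrix (Fin d) (Fin d) ℂ) → _) := by
  refine continuous_pi fun x => continuous_pi fun i => ?_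
  refine continuous_finsetSum _ fun j _ => ?_
  split_ifs <;> fun_prop

variable (d k) in
/-- The convex cone of marginals of families of positive semidefinite matrices. -/
def marginalCone : Set ((x : Fin g) → Fin (k x) → Matrix (Fin d) (Fin d) ℂ) :=
  marginals '' {J | ∀ j, (J j).PosSemidef}

theorem convex_marginalCone : Convex ℝ (marginalCone d k) := by
  rintro _ ⟨J, hJ, rfl⟩ _ ⟨K, hK, rfl⟩ a b ha hb -
  refine ⟨a • J + b • K, fun j => ?_, by rw [marginals_add, marginals_smul, marginals_smul]⟩
  exact ((hJ j).real_smul ha).add ((hK j).real_smul hb)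

/-- The total trace of $J$ can be read off from its marginal at $x_0$. So the points of the cone
near a given $p$ come from a compact set of families $J$, whose image is closed. -/
theorem isClosed_marginalCone (x₀ : Fin g) : IsClosed (marginalCone d k) := by
  let t : ((x : Fin g) → Fin (k x) → Matrix (Fin d) (Fin d) ℂ) → ℝ :=
    fun M => (∑ i, M x₀ i).trace.re
  have ht : Continuous t := by fun_prop
  have htJ : ∀ J, t (marginals J) = ∑ j, (J j).trace.re := fun J => by
    simp only [t, marginals]
    rw [sum_marginals, Matrix.trace_sum, Complex.re_sum]
  have hcompact : ∀ R : ℝ, IsCompact {J : ((x : Fin g) → Fin (k x)) → Matrix (Fin d) (Fin d) ℂ |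
      (∀ j, (J j).PosSemidef) ∧ ∑ j, (J j).trace.re ≤ R} := fun R => by
    refine IsCompact.of_isClosed_subset
      (isCompact_univ_pi fun _ => Matrix.isCompact_setOf_norm_apply_le R) ?_ ?_
    · have hcont : Continuous fun J : ((x : Fin g) → Fin (k x)) → Matrix (Fin d) (Fin d) ℂ =>
          ∑ j, (J j).trace.re := by fun_prop
      have hpsd : IsClosed {J : ((x : Fin g) → Fin (k x)) → Matrix (Fin d) (Fin d) ℂ |
          ∀ j, (J j).PosSemidef} := by
        simpa [Set.pi] using isClosed_set_pi (i := Set.univ)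
          fun (_ : (x : Fin g) → Fin (k x)) _ =>
            Matrix.isClosed_setOf_posSemidef (n := Fin d)
      exact hpsd.inter (isClosed_le hcont continuous_const)
    · rintro J ⟨hJ, hR⟩ j - a b
      refine ((hJ j).norm_apply_le a b).trans (le_trans ?_ hR)
      exact Finset.single_le_sum (f := fun j => (J j).trace.re)
        (fun j _ => (hJ j).re_trace_nonneg) (Finset.mem_univ j)
  refine isClosed_of_closure_subset fun p hp => ?_
  have hclosed := ((hcompact (t p + 1)).image continuous_marginals).isClosed
  have hp' : p ∈ closure ({M | t M < t p + 1} ∩ marginalCone d k) :=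
    (isOpen_lt ht continuous_const).inter_closure ⟨lt_add_one (t p), hp⟩
  have hsub : {M | t M < t p + 1} ∩ marginalCone d k ⊆ marginals '' {J |
      (∀ j, (J j).PosSemidef) ∧ ∑ j, (J j).trace.re ≤ t p + 1} := by
    rintro _ ⟨h1, J, hJ, rfl⟩
    exact ⟨J, ⟨hJ, by rw [← htJ]; exact le_of_lt h1⟩, rfl⟩
  obtain ⟨J, hJ, rfl⟩ := closure_minimal hsub hclosed hp'
  exact ⟨J, hJ.1, rfl⟩

theorem exists_re_sum_trace_mul_eq
    (f : ((x : Fin g) → Fin (k x) → Matrix (Fin d) (Fin d) ℂ) →ₗ[ℝ] ℝ) :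
    ∃ Y : (x : Fin g) → Fin (k x) → Matrix (Fin d) (Fin d) ℂ, (∀ x i, (Y x i).IsHermitian) ∧
      ∀ M : (x : Fin g) → Fin (k x) → Matrix (Fin d) (Fin d) ℂ, (∀ x i, (M x i).IsHermitian) →
        f M = (∑ x, ∑ i, (Y x i * M x i).trace).re := by
  have h := fun (x : Fin g) (i : Fin (k x)) => Matrix.exists_re_trace_mul_eq
    (f ∘ₗ LinearMap.single ℝ (fun x => Fin (k x) → Matrix (Fin d) (Fin d) ℂ) x ∘ₗ
      LinearMap.single ℝ (fun _ : Fin (k x) => Matrix (Fin d) (Fin d) ℂ) i)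
  choose Y hY hYf using h
  refine ⟨Y, hY, fun M hM => ?_⟩
  have hdecomp : M = ∑ x, Pi.single x (∑ i, Pi.single i (M x i)) := by
    simp only [Finset.univ_sum_single]
  simp only [Complex.re_sum, ← hYf _ _ _ (hM _ _)]
  conv_lhs => rw [hdecomp]
  rw [map_sum]
  refine Finset.sum_congr rfl fun x _ => ?_
  have := map_sum (f ∘ₗ LinearMap.single ℝ (fun x => Fin (k x) → Matrix (Fin d) (Fin d) ℂ) x)
    (fun i => Pi.single i (M x i)) Finset.univ
  exact this

theorem compatible_iff_mem_marginalCone [Nonempty (Fin g)]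
    {F : (x : Fin g) → Fin (k x) → Matrix (Fin d) (Fin d) ℂ} (hF : ∀ x, ∑ i, F x i = 1) :
    Compatible F ↔ F ∈ marginalCone d k := by
  constructor
  · rintro ⟨J, hJ, hJF⟩
    exact ⟨J, hJ.posSemidef, funext fun x => funext fun i => (hJF x i).symm⟩
  · rintro ⟨J, hJ, rfl⟩
    refine ⟨J, ⟨hJ, ?_⟩, fun _ _ => rfl⟩
    obtain ⟨x₀⟩ := ‹Nonempty (Fin g)›
    rw [← hF x₀]
    exact (sum_marginals x₀ J).symm

theorem exists_separating_of_not_compatible [Nonempty (Fin g)]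
    {F : (x : Fin g) → Fin (k x) → Matrix (Fin d) (Fin d) ℂ} (hF : ∀ x, ∑ i, F x i = 1)
    (hH : ∀ x i, (F x i).IsHermitian) (hnot : ¬ Compatible F) :
    ∃ Y : (x : Fin g) → Fin (k x) → Matrix (Fin d) (Fin d) ℂ, (∀ x i, (Y x i).IsHermitian) ∧
      (∀ j : (x : Fin g) → Fin (k x), (-∑ x, Y x (j x)).PosSemidef) ∧
      0 < (∑ x, ∑ i, (Y x i * F x i).trace).re := by
  rw [compatible_iff_mem_marginalCone hF] at hnot
  have : LocallyConvexSpace ℝ (Matrix (Fin d) (Fin d) ℂ) :=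
    inferInstanceAs (LocallyConvexSpace ℝ (Fin d → Fin d → ℂ))
  obtain ⟨f, u, hfu, huF⟩ := geometric_hahn_banach_closed_point convex_marginalCone
    (isClosed_marginalCone (d := d) (k := k) (Classical.arbitrary (Fin g))) hnot
  obtain ⟨Y, hY, hYf'⟩ := exists_re_sum_trace_mul_eq f.toLinearMap
  have hYf : ∀ M : (x : Fin g) → Fin (k x) → Matrix (Fin d) (Fin d) ℂ,
      (∀ x i, (M x i).IsHermitian) → f M = (∑ x, ∑ i, (Y x i * M x i).trace).re := hYf'
  have hu : 0 < u := by
    have := hfu 0 ⟨0, fun _ => PosSemidef.zero, by simpa using marginals_smul (d := d) (k := k) 0 0⟩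
    rwa [map_zero] at this
  -- On a cone, a functional bounded above is nonpositive: a positive value could be rescaled to
  -- equal $u$.
  have hcone : ∀ J : ((x : Fin g) → Fin (k x)) → Matrix (Fin d) (Fin d) ℂ,
      (∀ j, (J j).PosSemidef) → f (marginals J) ≤ 0 := fun J hJ => by
    by_contra! hpos
    have := hfu (marginals ((u / f (marginals J)) • J))
      ⟨_, fun j => (hJ j).real_smul (by positivity), rfl⟩
    rw [marginals_smul, map_smul, smul_eq_mul, div_mul_cancel₀ _ hpos.ne'] at this
    exact lt_irrefl _ this
  refine ⟨Y, hY, fun j => ?_, ?_⟩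
  · refine IsHermitian.posSemidef_of_re_trace_mul_nonneg
      (IsHermitian.sum fun x _ => hY x (j x)).neg fun P hP => ?_
    -- Testing on families supported at the single tuple $j$ isolates $\sum_x Y_{x,j_x}$.
    have hJ : ∀ l, (Pi.single (M := fun _ => Matrix (Fin d) (Fin d) ℂ) j P l).PosSemidef :=
      fun l => by
        by_cases h : l = j
        · subst h; simpa using hP
        · rw [Pi.single_eq_of_ne h]; exact PosSemidef.zero
    have h1 := hcone _ hJ
    have h2 := hYf (marginals (Pi.single j P)) fun x i => IsHermitian.sum fun l _ => by
      split_ifs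
      exacts [(hJ l).isHermitian, isHermitian_zero]
    simp only [marginals, sum_trace_mul_marginals] at h2
    rw [Finset.sum_eq_single j (fun l _ hl => by rw [Pi.single_eq_of_ne hl]; simp) (by simp),
      Pi.single_eq_same] at h2
    rw [Matrix.neg_mul, Matrix.trace_neg, Complex.neg_re, ← h2]
    exact neg_nonneg.mpr h1
  · rw [← hYf F hH]
    exact hu.trans huF

end Separation

/-! ### Strong duality: incompatibility produces feasible points -/

section LowerBound

open Matrix

variable {d g : ℕ} {k : Fin g → ℕ}

theorem isHermitian_noisy
    {E : (x : Fin g) → Fin (k x) → Matrix (Fin d) (Fin d) ℂ} (hE : ∀ x, IsPOVM (E x)) (s : ℝ)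
    (x : Fin g) (i : Fin (k x)) : (noisy s E x i).IsHermitian :=
  (((hE x).posSemidef i).isHermitian.real_smul s).add (isHermitian_one.real_smul _)

theorem sum_noisy (hk : ∀ x, 1 ≤ k x)
    {E : (x : Fin g) → Fin (k x) → Matrix (Fin d) (Fin d) ℂ} (hE : ∀ x, IsPOVM (E x)) (s : ℝ)
    (x : Fin g) : ∑ i, noisy s E x i = 1 := by
  have hk0 : (k x : ℝ) ≠ 0 := by
    have := hk x
    exact_mod_cast (by omega : k x ≠ 0)
  simp only [noisy, Finset.sum_add_distrib, ← Finset.smul_sum, (hE x).sum_eq_one,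
    Finset.sum_const, Finset.card_univ, Fintype.card_fin]
  rw [← Nat.cast_smul_eq_nsmul ℝ, smul_smul, mul_comm, mul_div_cancel₀ _ hk0, ← add_smul]
  simp

/-- With $G=B^*B$, conjugating $W$ by $B^{-1}$ turns the bound $G$ into $I$. The inverse conjugation
falls on the deviations of $E$, and $N=BB^*$ has the same trace as $G$. -/
theorem traceFeasible_of_posDef (hd : 1 ≤ d) (hk : ∀ x, 1 ≤ k x)
    {E : (x : Fin g) → Fin (k x) → Matrix (Fin d) (Fin d) ℂ} (hE : ∀ x, IsPOVM (E x))
    {W : (x : Fin g) → Fin (k x - 1) → Matrix (Fin d) (Fin d) ℂ}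
    (hW : ∀ x i, (W x i).IsHermitian) {G : Matrix (Fin d) (Fin d) ℂ} (hG : G.PosDef)
    (hGW : ∀ j, (G - outcomeSum W j).PosSemidef) (htr : G.trace = d) :
    ∃ A X N, TraceFeasible (d := d) (k := k) A X N ∧ traceObjective A X = (1 / (d : ℝ)) *
      (∑ x, ∑ i, ((2 : ℝ) • (E x (Fin.castLE (Nat.sub_le _ 1) i) - (1 / (k x : ℝ)) • 1) *
        W x i).trace).re := by
  obtain ⟨B, C, rfl, hBC, hCB⟩ := hG.exists_eq_conjTranspose_mul_self
  have hCB' : Bᴴ * Cᴴ = 1 := by rw [← conjTranspose_mul, hCB, conjTranspose_one]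
  have hBC' : Cᴴ * Bᴴ = 1 := by rw [← conjTranspose_mul, hBC, conjTranspose_one]
  have hkpos : ∀ x, (0 : ℝ) < k x := fun x => by exact_mod_cast hk x
  have hD : ∀ x i, ((2 : ℝ) • (E x i - (1 / (k x : ℝ)) • 1)).IsHermitian := fun x i =>
    (((hE x).posSemidef i).isHermitian.sub (isHermitian_one.real_smul _)).real_smul _
  refine ⟨fun x i => B * ((2 : ℝ) • (E x (Fin.castLE (Nat.sub_le _ 1) i) -
    (1 / (k x : ℝ)) • 1)) * Bᴴ, fun x i => Cᴴ * W x i * C, B * Bᴴ,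
    ⟨fun x i => ?_, fun x i => ?_, fun x i => ?_, fun x => ?_, fun j => ?_,
      posSemidef_self_mul_conjTranspose B, ?_⟩, ?_⟩
  · exact isHermitian_mul_mul_conjTranspose _ (hD x _)
  · exact isHermitian_conjTranspose_mul_mul _ (hW x i)
  · have hx := hkpos x
    have := (((hE x).posSemidef (Fin.castLE (Nat.sub_le _ 1) i)).mul_mul_conjTranspose_same
      B).real_smul hx.le
    convert this using 1
    simp only [Matrix.mul_smul, Matrix.smul_mul, Matrix.mul_sub, Matrix.sub_mul, Matrix.mul_one,
      smul_sub, smul_smul]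
    have h1 : -((k x : ℝ) / 2) * 2 = -k x := by ring
    have h2 : -((k x : ℝ) / 2) * (2 * (1 / k x)) = -1 := by field_simp
    simp only [h1, h2]
    module
  · have hx := hkpos x
    -- The slack in the upper constraint is $k_x$ times the conjugated last effect, just as the
    -- other effects give the slacks in the lower constraints.
    have := (((hE x).posSemidef ⟨k x - 1, by have := hk x; omega⟩).mul_mul_conjTranspose_same
      B).real_smul hx.le
    convert this using 1
    have hsum := (hE x).sum_eq_one
    rw [Fin.sum_univ_castLE_pred_add_last (hk x)] at hsum
    rw [eq_sub_of_add_eq' hsum, ← Finset.sum_mul, ← Finset.mul_sum, ← Finset.smul_sum,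
      Finset.sum_sub_distrib, Finset.sum_const, Finset.card_univ, Fintype.card_fin,
      ← Nat.cast_smul_eq_nsmul ℝ, smul_smul, Nat.cast_sub (hk x), Nat.cast_one]
    have h0 : ((k x : ℝ) - 1) * (1 / k x) = 1 - 1 / k x := by field_simp
    rw [h0]
    simp only [Matrix.mul_smul, Matrix.smul_mul, Matrix.mul_sub, Matrix.sub_mul, Matrix.mul_one,
      smul_sub, smul_smul]
    have h1 : ((k x : ℝ) / 2) * 2 = k x := by ring
    have h2 : ((k x : ℝ) / 2) * (2 * (1 - 1 / k x)) = k x - 1 := by field_simp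
    simp only [h1, h2]
    module
  · have := (hGW j).conjTranspose_mul_mul_same C
    rw [Matrix.mul_sub, Matrix.sub_mul, ← Matrix.mul_assoc, hBC', Matrix.one_mul, hBC,
      ← outcomeSum_conj] at this
    exact this
  · rw [Matrix.trace_mul_comm, htr, one_div_mul_cancel]
    exact_mod_cast (by omega : d ≠ 0)
  · rw [traceObjective]
    congr 2
    refine Finset.sum_congr rfl fun x _ => Finset.sum_congr rfl fun i _ => ?_
    rw [Matrix.mul_assoc, Matrix.mul_assoc, Matrix.trace_mul_comm]
    have : Bᴴ * (Cᴴ * W x i * C) * B = (Bᴴ * Cᴴ) * W x i * (C * B) := by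
      simp only [Matrix.mul_assoc]
    rw [Matrix.mul_assoc, this, hCB, hCB', Matrix.one_mul, Matrix.mul_one]

theorem posSemidef_of_forall_sub_outcomeSum (hk : ∀ x, 1 ≤ k x)
    {W : (x : Fin g) → Fin (k x - 1) → Matrix (Fin d) (Fin d) ℂ}
    {G : Matrix (Fin d) (Fin d) ℂ} (h : ∀ j, (G - outcomeSum W j).PosSemidef) :
    G.PosSemidef := by
  have hsum := posSemidef_sum Finset.univ fun j _ => h j
  have : ∀ x, Nonempty (Fin (k x)) := fun x => ⟨⟨0, hk x⟩⟩
  have hpos : (0 : ℝ) < Fintype.card ((x : Fin g) → Fin (k x)) := by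
    exact_mod_cast Fintype.card_pos
  rw [Finset.sum_sub_distrib, sum_outcomeSum, sub_zero, Finset.sum_const, Finset.card_univ,
    ← Nat.cast_smul_eq_nsmul ℝ] at hsum
  have := hsum.real_smul (inv_nonneg.mpr hpos.le)
  rwa [inv_smul_smul₀ hpos.ne'] at this

/-- The strict inequality leaves room to add $\varepsilon I$ to $G$, making it positive definite.
The remaining conditions are homogeneous in $(W,G)$, so the trace can be scaled to $d$. -/
theorem exists_traceFeasible_of_lt (hd : 1 ≤ d) (hk : ∀ x, 1 ≤ k x)
    {E : (x : Fin g) → Fin (k x) → Matrix (Fin d) (Fin d) ℂ} (hE : ∀ x, IsPOVM (E x))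
    {W : (x : Fin g) → Fin (k x - 1) → Matrix (Fin d) (Fin d) ℂ}
    (hW : ∀ x i, (W x i).IsHermitian) {G : Matrix (Fin d) (Fin d) ℂ}
    (hGW : ∀ j, (G - outcomeSum W j).PosSemidef) {s : ℝ} (hs : 0 < s)
    (hlt : G.trace.re < s * (∑ x, ∑ i, ((2 : ℝ) • (E x (Fin.castLE (Nat.sub_le _ 1) i) -
      (1 / (k x : ℝ)) • 1) * W x i).trace).re) :
    ∃ A X N, TraceFeasible (d := d) (k := k) A X N ∧ 1 / s < traceObjective A X := by
  set v := (∑ x, ∑ i, ((2 : ℝ) • (E x (Fin.castLE (Nat.sub_le _ 1) i) -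
      (1 / (k x : ℝ)) • 1) * W x i).trace).re with hv
  have hd0 : (0 : ℝ) < d := by exact_mod_cast hd
  have hG := posSemidef_of_forall_sub_outcomeSum hk hGW
  -- Chosen so that $\operatorname{tr}(\varepsilon I)$ uses up half of the gap.
  set ε := (s * v - G.trace.re) / (2 * d) with hε
  have hε0 : 0 < ε := div_pos (sub_pos.mpr hlt) (by positivity)
  have hG' : (G + ε • (1 : Matrix (Fin d) (Fin d) ℂ)).PosDef :=
    PosDef.posSemidef_add hG (PosDef.one.smul hε0)
  have : Nonempty (Fin d) := ⟨⟨0, hd⟩⟩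
  set τ := (G + ε • (1 : Matrix (Fin d) (Fin d) ℂ)).trace.re with hτ
  have hτc : (G + ε • (1 : Matrix (Fin d) (Fin d) ℂ)).trace = τ :=
    Complex.ext rfl (by simpa using (Complex.lt_def.mp hG'.trace_pos).2.symm)
  have hτ0 : 0 < τ := (Complex.lt_def.mp hG'.trace_pos).1
  have hτv : τ < s * v := by
    have h1 : τ = G.trace.re + ε * d := by
      rw [hτ, Matrix.trace_add, Matrix.trace_smul, Matrix.trace_one, Fintype.card_fin,
        Complex.add_re, Complex.smul_re, Complex.natCast_re, smul_eq_mul]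
    have h2 : ε * d = (s * v - G.trace.re) / 2 := by
      rw [hε]
      field_simp
    linarith
  have hc : 0 < (d : ℝ) / τ := by positivity
  obtain ⟨A, X, N, hf, hobj⟩ := traceFeasible_of_posDef hd hk hE
    (W := fun x i => ((d : ℝ) / τ) • W x i) (fun x i => (hW x i).real_smul _)
    (G := ((d : ℝ) / τ) • (G + ε • (1 : Matrix (Fin d) (Fin d) ℂ))) (hG'.smul hc)
    (fun j => by
      rw [outcomeSum_smul, ← smul_sub, add_sub_right_comm]
      exact ((hGW j).add (PosSemidef.one.real_smul hε0.le)).real_smul hc.le)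
    (by
      rw [Matrix.trace_smul, hτc, Complex.real_smul, ← Complex.ofReal_mul,
        div_mul_cancel₀ _ hτ0.ne', Complex.ofReal_natCast])
  refine ⟨A, X, N, hf, ?_⟩
  rw [hobj]
  simp only [Matrix.mul_smul]
  have : (∑ x, ∑ i, (((d : ℝ) / τ) • ((2 : ℝ) • (E x (Fin.castLE (Nat.sub_le _ 1) i) -
      (1 / (k x : ℝ)) • 1) * W x i)).trace).re = ((d : ℝ) / τ) * v := by
    simp only [Matrix.trace_smul ((d : ℝ) / τ), ← Finset.smul_sum, Complex.smul_re, hv,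
      smul_eq_mul]
  rw [this, div_lt_iff₀ hs]
  have : 1 / (d : ℝ) * (d / τ * v) * s = s * v / τ := by field_simp
  rw [this, lt_div_iff₀ hτ0]
  linarith

theorem exists_traceFeasible_of_not_compatible [Nonempty (Fin g)] (hd : 1 ≤ d)
    (hk : ∀ x, 1 ≤ k x) {E : (x : Fin g) → Fin (k x) → Matrix (Fin d) (Fin d) ℂ}
    (hE : ∀ x, IsPOVM (E x)) {s : ℝ} (hs : 0 < s) (hnot : ¬ Compatible (noisy s E)) :
    ∃ A X N, TraceFeasible (d := d) (k := k) A X N ∧ 1 / s < traceObjective A X := by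
  obtain ⟨Y, hY, hYneg, hYpos⟩ := exists_separating_of_not_compatible (sum_noisy hk hE s)
    (isHermitian_noisy hE s) hnot
  let last : (x : Fin g) → Fin (k x) := fun x => ⟨k x - 1, by have := hk x; omega⟩
  -- The last outcome is the reference. The factor $\frac12$ matches the coefficient
  -- $2\delta_{i,j_x}$, and $G$ is fixed by requiring $G-$`outcomeSum W j` $=-\sum_x Y_{x,j_x}$.
  let W : (x : Fin g) → Fin (k x - 1) → Matrix (Fin d) (Fin d) ℂ := fun x i =>
    (1 / 2 : ℝ) • (Y x (Fin.castLE (Nat.sub_le _ 1) i) - Y x (last x))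
  let G : Matrix (Fin d) (Fin d) ℂ :=
    -∑ x, Y x (last x) - ∑ x, ∑ i, (2 / (k x : ℝ)) • W x i
  refine exists_traceFeasible_of_lt hd hk hE (W := W) (G := G)
    (fun x i => ((hY _ _).sub (hY _ _)).real_smul _) (fun j => ?_) hs ?_
  · convert hYneg j using 1
    have : ∀ x, ∑ i : Fin (k x - 1), (2 * (if (i : ℕ) = (j x : ℕ) then 1 else 0) : ℝ) • W x i =
        Y x (j x) - Y x (last x) := fun x => by
      by_cases h : (j x : ℕ) < k x - 1
      · rw [Finset.sum_eq_single ⟨j x, h⟩]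
        · simp [W, smul_smul]
        · intro b _ hb
          rw [if_neg (fun hb' => hb (Fin.ext hb'))]
          simp
        · simp
      · have hj : j x = last x := Fin.ext (by have := (j x).2; simp only [last]; omega)
        rw [hj, sub_self]
        refine Finset.sum_eq_zero fun i _ => ?_
        rw [if_neg (by have := i.2; simp only [last]; omega)]
        simp
    simp only [outcomeSum, add_smul, Finset.sum_add_distrib, this, neg_smul, G,
      Finset.sum_neg_distrib, Finset.sum_sub_distrib]
    abel
  · have hx : ∀ x, ∑ i, Y x i * noisy s E x i = Y x (last x) + ∑ i, (2 / (k x : ℝ)) • W x i +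
        s • ∑ i, W x i * ((2 : ℝ) • (E x (Fin.castLE (Nat.sub_le _ 1) i) -
          (1 / (k x : ℝ)) • 1)) := fun x => by
      have h1 := sum_noisy hk hE s x
      rw [Fin.sum_univ_castLE_pred_add_last (hk x)] at h1 ⊢
      have h2 : noisy s E x (last x) = _ := eq_sub_of_add_eq' h1
      change _ + Y x (last x) * noisy s E x (last x) = _
      rw [h2, Matrix.mul_sub, Matrix.mul_one, Finset.mul_sum, Finset.smul_sum, add_comm,
        sub_add_eq_add_sub, add_sub_assoc, ← Finset.sum_sub_distrib, add_assoc,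
        ← Finset.sum_add_distrib]
      congr 1
      refine Finset.sum_congr rfl fun i _ => ?_
      simp only [W, noisy, Matrix.mul_add, Matrix.mul_smul, Matrix.mul_one, Matrix.mul_sub,
        Matrix.smul_mul, Matrix.sub_mul]
      match_scalars <;> ring
    have hre : (∑ x, ∑ i, (Y x i * noisy s E x i).trace).re = -G.trace.re +
        s * (∑ x, ∑ i, ((2 : ℝ) • (E x (Fin.castLE (Nat.sub_le _ 1) i) -
          (1 / (k x : ℝ)) • 1) * W x i).trace).re := by
      simp only [← Matrix.trace_sum, hx, Finset.sum_add_distrib, Matrix.trace_add, Complex.add_re]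
      rw [← Finset.smul_sum, Matrix.trace_smul, Complex.smul_re, smul_eq_mul]
      congr 1
      · simp only [G, Matrix.trace_sub, Matrix.trace_neg, Complex.sub_re, Complex.neg_re]
        ring
      · simp only [Matrix.trace_sum, Matrix.trace_mul_comm (W _ _)]
    rw [hre] at hYpos
    linarith

end LowerBound

/-! ### Compactness of the feasible set and existence of a maximiser -/

section Compactness

open Matrix

variable {d g : ℕ} {k : Fin g → ℕ}

theorem TraceFeasible.trace_eq (hd : 1 ≤ d)
    {A X : (x : Fin g) → Fin (k x - 1) → Matrix (Fin d) (Fin d) ℂ}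
    {N : Matrix (Fin d) (Fin d) ℂ} (h : TraceFeasible A X N) : N.trace = d := by
  have ht := h.trace_N
  have hd0 : (d : ℂ) ≠ 0 := by exact_mod_cast (by omega : d ≠ 0)
  rw [one_div, inv_mul_eq_one₀ hd0] at ht
  exact ht.symm

theorem TraceFeasible.norm_N_le (hd : 1 ≤ d)
    {A X : (x : Fin g) → Fin (k x - 1) → Matrix (Fin d) (Fin d) ℂ}
    {N : Matrix (Fin d) (Fin d) ℂ} (h : TraceFeasible A X N) (a b : Fin d) : ‖N a b‖ ≤ d := by
  simpa [h.trace_eq hd] using h.posSemidef_N.norm_apply_le a b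

/-- For fixed $x$ the $k_x$ positive semidefinite slacks add up to $k_xN$, so each lower slack has
trace at most $k_xd$; subtracting $N$ bounds $\frac{k_x}2A_{i|x}$. -/
theorem TraceFeasible.norm_A_le (hd : 1 ≤ d) (hk : ∀ x, 1 ≤ k x)
    {A X : (x : Fin g) → Fin (k x - 1) → Matrix (Fin d) (Fin d) ℂ}
    {N : Matrix (Fin d) (Fin d) ℂ} (h : TraceFeasible A X N) (x : Fin g) (i : Fin (k x - 1))
    (a b : Fin d) : ‖A x i a b‖ ≤ 2 * (k x + 1) * d := by
  set Q : Fin (k x - 1) → Matrix (Fin d) (Fin d) ℂ := fun i => N - (-((k x : ℝ) / 2)) • A x i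
    with hQ
  have hk1 : (1 : ℝ) ≤ k x := by exact_mod_cast hk x
  have hsum : (∑ i, Q i) + (N - ((k x : ℝ) / 2) • ∑ i, A x i) = (k x : ℝ) • N := by
    simp only [hQ, Finset.sum_sub_distrib, ← Finset.smul_sum, Finset.sum_const, Finset.card_univ,
      Fintype.card_fin]
    rw [← Nat.cast_smul_eq_nsmul ℝ, Nat.cast_sub (hk x), Nat.cast_one]
    module
  have htr : ∑ i, (Q i).trace.re + (N - ((k x : ℝ) / 2) • ∑ i, A x i).trace.re = k x * d := by
    rw [← Complex.re_sum, ← Matrix.trace_sum, ← Complex.add_re, ← Matrix.trace_add, hsum,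
      Matrix.trace_smul, h.trace_eq hd, Complex.smul_re, Complex.natCast_re, smul_eq_mul]
  have hQi : (Q i).trace.re ≤ k x * d := by
    have h1 := Finset.single_le_sum (f := fun i => (Q i).trace.re)
      (fun i _ => (h.lower_A x i).re_trace_nonneg) (Finset.mem_univ i)
    have h2 := (h.upper_A x).re_trace_nonneg
    linarith
  have hQab := ((h.lower_A x i).norm_apply_le a b).trans hQi
  have hNab := h.norm_N_le hd a b
  have hA : ((k x : ℝ) / 2) • A x i a b = Q i a b - N a b := by
    simp [hQ]
  have hnorm : (k x : ℝ) / 2 * ‖A x i a b‖ ≤ k x * d + d := by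
    have h1 := congrArg norm hA
    rw [norm_smul, Real.norm_of_nonneg (by positivity)] at h1
    rw [h1]
    exact (norm_sub_le _ _).trans (add_le_add hQab hNab)
  nlinarith [norm_nonneg (A x i a b)]

/-- At the last outcome no $\delta_{i,j_x}$ fires, because $i$ stops one short of it; changing one
coordinate switches on a single term. -/
theorem outcomeSum_update_sub (X : (x : Fin g) → Fin (k x - 1) → Matrix (Fin d) (Fin d) ℂ)
    (last : (x : Fin g) → Fin (k x)) (hlast : ∀ x, (last x : ℕ) = k x - 1) (x : Fin g)
    (i : Fin (k x - 1)) :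
    outcomeSum X (Function.update last x (Fin.castLE (Nat.sub_le _ 1) i)) - outcomeSum X last =
      (2 : ℝ) • X x i := by
  simp only [outcomeSum, ← Finset.sum_sub_distrib, ← sub_smul]
  rw [Finset.sum_eq_single x, Finset.sum_eq_single i]
  · have : (i : ℕ) ≠ k x - 1 := i.2.ne
    simp [hlast, this]
  · intro l _ hl
    have h1 : (l : ℕ) ≠ k x - 1 := l.2.ne
    have h2 : (l : ℕ) ≠ i := fun h => hl (Fin.ext h)
    simp [hlast, h1, h2]
  · simp
  · intro y _ hy
    simp [Function.update_of_ne hy]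
  · simp

/-- The slacks over all $j$ sum to a multiple of the identity, so each is bounded, and a difference
of two of them is $2X_{i|x}$. -/
theorem TraceFeasible.norm_X_le (hk : ∀ x, 1 ≤ k x)
    {A X : (x : Fin g) → Fin (k x - 1) → Matrix (Fin d) (Fin d) ℂ}
    {N : Matrix (Fin d) (Fin d) ℂ} (h : TraceFeasible A X N) (x : Fin g) (i : Fin (k x - 1))
    (a b : Fin d) : ‖X x i a b‖ ≤ Fintype.card ((x : Fin g) → Fin (k x)) * d := by
  have hpsd : ∀ j, (1 - outcomeSum X j).PosSemidef := h.constraint_X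
  have htr : ∑ j, (1 - outcomeSum X j).trace.re =
      Fintype.card ((x : Fin g) → Fin (k x)) * d := by
    rw [← Complex.re_sum, ← Matrix.trace_sum, Finset.sum_sub_distrib, sum_outcomeSum,
      sub_zero, Finset.sum_const, Finset.card_univ, Matrix.trace_smul, Matrix.trace_one,
      Fintype.card_fin, nsmul_eq_mul, ← Nat.cast_mul, Complex.natCast_re, Nat.cast_mul]
  have hle : ∀ j, ‖(1 - outcomeSum X j) a b‖ ≤ Fintype.card ((x : Fin g) → Fin (k x)) * d :=
    fun j => ((hpsd j).norm_apply_le a b).trans <| htr ▸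
      Finset.single_le_sum (f := fun j => (1 - outcomeSum X j).trace.re)
        (fun j _ => (hpsd j).re_trace_nonneg) (Finset.mem_univ j)
  let last : (x : Fin g) → Fin (k x) := fun x => ⟨k x - 1, by have := hk x; omega⟩
  have h1 := outcomeSum_update_sub X last (fun _ => rfl) x i
  have h2 : (2 : ℝ) • X x i a b = (1 - outcomeSum X last) a b -
      (1 - outcomeSum X (Function.update last x (Fin.castLE (Nat.sub_le _ 1) i))) a b := by
    rw [← Matrix.smul_apply, ← h1]
    simp
  have h3 := congrArg norm h2
  rw [norm_smul, Real.norm_of_nonneg zero_le_two] at h3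
  have h4 := norm_sub_le ((1 - outcomeSum X last) a b)
    ((1 - outcomeSum X (Function.update last x (Fin.castLE (Nat.sub_le _ 1) i))) a b)
  linarith [hle last, hle (Function.update last x (Fin.castLE (Nat.sub_le _ 1) i))]

variable (d k) in
/-- The type of triples `(A, X, N)`. -/
abbrev TracePoint : Type :=
  ((x : Fin g) → Fin (k x - 1) → Matrix (Fin d) (Fin d) ℂ) ×
    ((x : Fin g) → Fin (k x - 1) → Matrix (Fin d) (Fin d) ℂ) × Matrix (Fin d) (Fin d) ℂ

variable (d k) in
/-- The set of feasible points `(A, X, N)`. -/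
def feasibleSet : Set (TracePoint d k) :=
  {p | TraceFeasible p.1 p.2.1 p.2.2}

theorem isClosed_feasibleSet : IsClosed (feasibleSet d k) := by
  have hH := Matrix.isClosed_setOf_isHermitian (n := Fin d)
  have hP := Matrix.isClosed_setOf_posSemidef (n := Fin d)
  have h1 : IsClosed (⋂ (x) (i), (fun p : TracePoint d k => p.1 x i) ⁻¹' {M | M.IsHermitian}) :=
    isClosed_iInter fun x => isClosed_iInter fun i => hH.preimage (by fun_prop)
  have h2 : IsClosed (⋂ (x) (i), (fun p : TracePoint d k => p.2.1 x i) ⁻¹' {M | M.IsHermitian}) :=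
    isClosed_iInter fun x => isClosed_iInter fun i => hH.preimage (by fun_prop)
  have h3 : IsClosed (⋂ (x) (i), (fun p : TracePoint d k => p.2.2 - (-((k x : ℝ) / 2)) • p.1 x i) ⁻¹'
      {M | M.PosSemidef}) :=
    isClosed_iInter fun x => isClosed_iInter fun i => hP.preimage (by fun_prop)
  have h4 : IsClosed (⋂ x, (fun p : TracePoint d k => p.2.2 - ((k x : ℝ) / 2) • ∑ i, p.1 x i) ⁻¹'
      {M | M.PosSemidef}) :=
    isClosed_iInter fun x => hP.preimage (by fun_prop)
  have h5 : IsClosed (⋂ j, (fun p : TracePoint d k => 1 - outcomeSum p.2.1 j) ⁻¹' {M | M.PosSemidef}) :=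
    isClosed_iInter fun j => hP.preimage (by unfold outcomeSum; fun_prop)
  have h6 : IsClosed ((fun p : TracePoint d k => p.2.2) ⁻¹' {M | M.PosSemidef}) := hP.preimage (by fun_prop)
  have h7 : IsClosed {p : TracePoint d k | (1 / (d : ℂ)) * p.2.2.trace = 1} :=
    isClosed_eq (by fun_prop) continuous_const
  convert ((((((h1.inter h2).inter h3).inter h4).inter h5).inter h6).inter h7) using 1
  ext p
  simp only [Set.mem_inter_iff, Set.mem_iInter, Set.mem_preimage, Set.mem_ofPred_eq]
  exact ⟨fun h => ⟨⟨⟨⟨⟨⟨h.1, h.2⟩, h.3⟩, h.4⟩, h.5⟩, h.6⟩, h.7⟩,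
    fun ⟨⟨⟨⟨⟨⟨h1, h2⟩, h3⟩, h4⟩, h5⟩, h6⟩, h7⟩ => ⟨h1, h2, h3, h4, h5, h6, h7⟩⟩

theorem isCompact_feasibleSet (hd : 1 ≤ d) (hk : ∀ x, 1 ≤ k x) :
    IsCompact (feasibleSet d k) := by
  refine IsCompact.of_isClosed_subset
    ((isCompact_univ_pi fun x => isCompact_univ_pi fun _ =>
      Matrix.isCompact_setOf_norm_apply_le (2 * (k x + 1) * d)).prod
    ((isCompact_univ_pi fun x => isCompact_univ_pi fun _ =>
      Matrix.isCompact_setOf_norm_apply_le (Fintype.card ((x : Fin g) → Fin (k x)) * d)).prod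
    (Matrix.isCompact_setOf_norm_apply_le d))) isClosed_feasibleSet ?_
  rintro ⟨A, X, N⟩ (h : TraceFeasible A X N)
  exact ⟨fun x _ i _ => h.norm_A_le hd hk x i, fun x _ i _ => h.norm_X_le hk x i, h.norm_N_le hd⟩

theorem exists_isMaxOn_traceObjective (hd : 1 ≤ d) (hk : ∀ x, 1 ≤ k x)
    (hne : ∃ A X N, TraceFeasible (d := d) (k := k) A X N) :
    ∃ A X N, TraceFeasible (d := d) (k := k) A X N ∧
      ∀ A' X' N', TraceFeasible (d := d) (k := k) A' X' N' →
        traceObjective A' X' ≤ traceObjective A X := by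
  obtain ⟨A, X, N, h⟩ := hne
  obtain ⟨p, hp, hmax⟩ := (isCompact_feasibleSet hd hk).exists_isMaxOn ⟨(A, X, N), h⟩
    (f := fun p => traceObjective p.1 p.2.1)
    (Continuous.continuousOn (by unfold traceObjective; fun_prop))
  exact ⟨p.1, p.2.1, p.2.2, hp, fun A' X' N' h' => hmax (a := (A', X', N')) h'⟩

end Compactness

/-! ### Regularisation, the deterministic example and the conclusion -/

section MainTheorem

open Matrix

variable {d g : ℕ} {k : Fin g → ℕ}

/-- A convex combination with the point $A=0$, $N=I$, keeping $X$ fixed. For $\varepsilon>0$ the new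
$N$ is positive definite, and the objective only shrinks by $1-\varepsilon$. -/
theorem TraceFeasible.regularize (hd : 1 ≤ d)
    {A X : (x : Fin g) → Fin (k x - 1) → Matrix (Fin d) (Fin d) ℂ}
    {N : Matrix (Fin d) (Fin d) ℂ} (h : TraceFeasible A X N) {ε : ℝ} (h0 : 0 ≤ ε)
    (h1 : ε ≤ 1) :
    TraceFeasible (fun x i => (1 - ε) • A x i) X ((1 - ε) • N + ε • 1) := by
  have hone : (ε • (1 : Matrix (Fin d) (Fin d) ℂ)).PosSemidef := PosSemidef.one.real_smul h0
  have hε : 0 ≤ 1 - ε := by linarith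
  refine ⟨fun x i => (h.hermitian_A x i).real_smul _, h.hermitian_X, fun x i => ?_, fun x => ?_,
    h.constraint_X, (h.posSemidef_N.real_smul hε).add hone, ?_⟩
  · convert ((h.lower_A x i).real_smul hε).add hone using 1
    module
  · convert ((h.upper_A x).real_smul hε).add hone using 1
    rw [← Finset.smul_sum]
    module
  · have hd0 : (d : ℂ) ≠ 0 := by exact_mod_cast (by omega : d ≠ 0)
    rw [Matrix.trace_add, Matrix.trace_smul, Matrix.trace_smul, h.trace_eq hd, Matrix.trace_one,
      Fintype.card_fin, ← add_smul]
    simp [hd0]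

theorem traceObjective_smul (c : ℝ)
    (A X : (x : Fin g) → Fin (k x - 1) → Matrix (Fin d) (Fin d) ℂ) :
    traceObjective (fun x i => c • A x i) X = c * traceObjective A X := by
  simp only [traceObjective, Matrix.smul_mul, Matrix.trace_smul, ← Finset.smul_sum,
    Complex.smul_re, smul_eq_mul]
  ring

theorem compatibilityDegree_nonneg (E : (x : Fin g) → Fin (k x) → Matrix (Fin d) (Fin d) ℂ) :
    0 ≤ compatibilityDegree E :=
  Real.sSup_nonneg fun _ hs => hs.1.1

theorem minCompatibilityDegree_nonneg : 0 ≤ minCompatibilityDegree d g k := by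
  refine Real.sInf_nonneg ?_
  rintro _ ⟨E, -, rfl⟩
  exact compatibilityDegree_nonneg E

theorem minCompatibilityDegree_le {E : (x : Fin g) → Fin (k x) → Matrix (Fin d) (Fin d) ℂ}
    (hE : ∀ x, IsPOVM (E x)) : minCompatibilityDegree d g k ≤ compatibilityDegree E := by
  refine csInf_le ⟨0, ?_⟩ ⟨E, hE, rfl⟩
  rintro _ ⟨E, -, rfl⟩
  exact compatibilityDegree_nonneg E

theorem TraceFeasible.minCompatibilityDegree_mul_le_one (hd : 1 ≤ d) (hk : ∀ x, 1 ≤ k x)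
    {A X : (x : Fin g) → Fin (k x - 1) → Matrix (Fin d) (Fin d) ℂ}
    {N : Matrix (Fin d) (Fin d) ℂ} (h : TraceFeasible A X N) :
    minCompatibilityDegree d g k * traceObjective A X ≤ 1 := by
  by_contra! hw
  set w := minCompatibilityDegree d g k * traceObjective A X with hwdef
  have hv : 0 < traceObjective A X :=
    pos_of_mul_pos_right (zero_lt_one.trans hw) minCompatibilityDegree_nonneg
  obtain ⟨ε, hε0, hε1, hεw⟩ : ∃ ε : ℝ, 0 < ε ∧ ε < 1 ∧ 1 < (1 - ε) * w := by
    -- This puts $(1-\varepsilon)w$ at the midpoint of $1$ and $w$.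
    refine ⟨(w - 1) / (2 * w), by apply div_pos <;> linarith, ?_, ?_⟩
    · rw [div_lt_one] <;> linarith
    · have : (1 - (w - 1) / (2 * w)) * w = (w + 1) / 2 := by
        field_simp
        ring
      linarith
  have hN : ((1 - ε) • N + ε • (1 : Matrix (Fin d) (Fin d) ℂ)).PosDef :=
    PosDef.posSemidef_add (h.posSemidef_N.real_smul (by linarith)) (PosDef.one.smul hε0)
  obtain ⟨E, hE, hbound⟩ :=
    (h.regularize hd hε0.le hε1.le).exists_mul_traceObjective_le_one hd hk hN
  rw [traceObjective_smul] at hbound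
  have hpos : 0 < (1 - ε) * traceObjective A X := mul_pos (by linarith) hv
  have hdeg : compatibilityDegree E ≤ 1 / ((1 - ε) * traceObjective A X) :=
    Real.sSup_le (fun s hs => (le_div_iff₀ hpos).mpr (hbound s hs.2)) (by positivity)
  have := (le_div_iff₀ hpos).mp ((minCompatibilityDegree_le hE).trans hdeg)
  rw [mul_left_comm] at this
  exact absurd hεw this.not_gt

theorem isPOVM_deterministic {k : ℕ} (hk : 1 ≤ k) :
    IsPOVM fun i : Fin k => if (i : ℕ) = 0 then (1 : Matrix (Fin d) (Fin d) ℂ) else 0 := by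
  refine ⟨fun i => ?_, ?_⟩
  · split_ifs
    exacts [PosSemidef.one, PosSemidef.zero]
  · rw [Finset.sum_eq_single ⟨0, hk⟩]
    · simp
    · intro i _ hi
      rw [if_neg fun h => hi (Fin.ext h)]
    · simp

theorem Compatible.posSemidef {E : (x : Fin g) → Fin (k x) → Matrix (Fin d) (Fin d) ℂ}
    (h : Compatible E) (x : Fin g) (i : Fin (k x)) : (E x i).PosSemidef := by
  obtain ⟨J, hJ, hJE⟩ := h
  rw [hJE]
  refine posSemidef_sum _ fun j _ => ?_
  split_ifs
  exacts [hJ.posSemidef j, PosSemidef.zero]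

/-- A measurement with at least two outcomes has a zero effect here, which becomes the negative
matrix $\frac{1-s}{k_x}I$ once $s>1$. Without such a measurement every level $s$ would be
compatible. -/
theorem not_compatible_noisy_deterministic (hd : 1 ≤ d) (hk2 : ∃ x, 2 ≤ k x) {s : ℝ}
    (hs : 1 < s) : ¬ Compatible (noisy s fun (x : Fin g) (i : Fin (k x)) =>
      if (i : ℕ) = 0 then (1 : Matrix (Fin d) (Fin d) ℂ) else 0) := by
  obtain ⟨x, hx⟩ := hk2
  intro h
  have h1 := (h.posSemidef x ⟨1, hx⟩).diag_nonneg (i := ⟨0, hd⟩)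
  have h2 := (Complex.le_def.mp h1).1
  simp only [noisy, one_ne_zero, if_false, smul_zero, zero_add, Matrix.smul_apply,
    Matrix.one_apply_eq, Complex.zero_re, Complex.smul_re, Complex.one_re, smul_eq_mul,
    mul_one] at h2
  have hk0 : (0 : ℝ) < k x := by exact_mod_cast (by omega : 0 < k x)
  have := div_neg_of_neg_of_pos (sub_neg.mpr hs) hk0
  linarith

end MainTheorem

theorem mainTheorem10 (d g : ℕ) (k : Fin g → ℕ) (hd : 1 ≤ d) (hk : ∀ x, 1 ≤ k x)
    (hk2 : ∃ x, 2 ≤ k x) :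
    IsGreatest
      {v : ℝ | ∃ (A X : (x : Fin g) → Fin (k x - 1) → Matrix (Fin d) (Fin d) ℂ)
        (N : Matrix (Fin d) (Fin d) ℂ), TraceFeasible A X N ∧ v = traceObjective A X}
      (1 / minCompatibilityDegree d g k) := by
  have : Nonempty (Fin g) := ⟨hk2.choose⟩
  -- Levels $s>1$ have no physical meaning but still yield feasible points with value above $1/s$;
  -- letting $s\downarrow1$ gives $V\ge1$, which places $1/V$ in $[0,1]$.
  have hdet := fun {s : ℝ} (hs : 1 < s) => exists_traceFeasible_of_not_compatible hd hk
    (fun x => isPOVM_deterministic (hk x)) (zero_lt_one.trans hs)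
    (not_compatible_noisy_deterministic hd hk2 hs)
  obtain ⟨A, X, N, hf, hmax⟩ := exists_isMaxOn_traceObjective (d := d) hd hk (by
    obtain ⟨A, X, N, h, -⟩ := hdet one_lt_two
    exact ⟨A, X, N, h⟩)
  set V := traceObjective A X with hV
  have hlt : ∀ s : ℝ, 1 < s → 1 / s < V := fun s hs => by
    obtain ⟨A', X', N', h, h'⟩ := hdet hs
    exact h'.trans_le (hmax _ _ _ h)
  have hV0 : 0 < V := (by norm_num : (0 : ℝ) < 1 / 2).trans (hlt 2 one_lt_two)
  have hV1 : 1 ≤ V := by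
    by_contra! h
    simpa using hlt (1 / V) ((one_lt_div hV0).mpr h)
  have hle : 1 / V ≤ minCompatibilityDegree d g k := by
    refine le_csInf ⟨_, _, fun x => isPOVM_deterministic (hk x), rfl⟩ ?_
    rintro _ ⟨E, hE, rfl⟩
    refine le_csSup ⟨1, fun s hs => hs.1.2⟩ ⟨⟨by positivity, (div_le_one hV0).mpr hV1⟩, ?_⟩
    -- Incompatibility at level $1/V$ would produce a feasible value strictly above the maximum $V$.
    by_contra hnot
    obtain ⟨A', X', N', h, h'⟩ :=
      exists_traceFeasible_of_not_compatible hd hk hE (one_div_pos.mpr hV0) hnot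
    rw [one_div_one_div] at h'
    exact absurd (hmax _ _ _ h) h'.not_ge
  have hge : minCompatibilityDegree d g k ≤ 1 / V :=
    (le_div_iff₀ hV0).mpr (hf.minCompatibilityDegree_mul_le_one hd hk)
  rw [le_antisymm hge hle, one_div_one_div]
  refine ⟨⟨A, X, N, hf, rfl⟩, ?_⟩
  rintro _ ⟨A', X', N', h, rfl⟩
  exact hmax _ _ _ h
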